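/- Let $n\ge 1$ and $\triangle=\{(x_1,\dots,x_n)\in\mathbb R^n : 1\ge x_1\ge\cdots\ge x_n\ge 0\}$. For each integer $b\ge 0$ let $$\triangle_b=\{x\in\triangle : 1-x_1-b\,x_n\ge 0>1-x_1-(b+1)x_n\},$$ and define the triangle map on $\bigcup_{b\ge 0}\triangle_b$ by $$T(x_1,\dots,x_n)=\Bigl(\frac{x_2}{x_1},\dots,\frac{x_n}{x_1},\frac{1-x_1-b\,x_n}{x_1}\Bigr)\qquad (x\in\triangle_b).$$ A triangle sequence of $x\in\triangle$ is a sequence $(b_0,b_1,b_2,\dots)$ of non-negative integers with $T^k(x)\in\triangle_{b_k}$ for all $k\ge 0$; there is at most one. Theorem. (1) Lebesgue-almost every $x\in\triangle$ has a triangle sequence, and it contains infinitely many strings of $n-1$ consecutive zeros: there are infinitely many $k\ge 0$ with $b_k=b_{k+1}=\cdots=b_{k+n-2}=0$. (2) For every real number $B\ge 0$ and Lebesgue-almost every $x\in\triangle$, the triangle sequence of $x$ exists and contains infinitely many strings of length $n-1$ bounded by $B$: there are infinitely many $k\ge 0$ with $b_k,b_{k+1},\dots,b_{k+n-2}\le B$.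 (For $n=1$ the strings are empty and the condition on them is vacuous.) -/

import Mathlib

open MeasureTheory

noncomputable section

namespace TriangleMap

/-- The simplex `1 ≥ x₁ ≥ ⋯ ≥ xₙ ≥ 0` in `ℝⁿ`, where `n = d + 1` ranges over all dimensions `n ≥ 1`.
The coordinate `x₁` is `x 0` and `xₙ` is `x (Fin.last d)`. -/
def simplex (d : ℕ) : Set (Fin (d + 1) → ℝ) :=
  {x | x 0 ≤ 1 ∧ Antitone x ∧ 0 ≤ x (Fin.last d)}

/-- The piece `△_b` of the simplex: `1 - x₁ - b xₙ ≥ 0 > 1 - x₁ - (b + 1) xₙ`. -/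
def cell (d b : ℕ) : Set (Fin (d + 1) → ℝ) :=
  {x | x ∈ simplex d ∧ 1 - x 0 - (b : ℝ) * x (Fin.last d) ≥ 0 ∧
    0 > 1 - x 0 - ((b : ℝ) + 1) * x (Fin.last d)}

/-- The number `b = ⌊(1 - x₁) / xₙ⌋`; it is the index of the piece that contains `x`
(see `digit_eq_of_mem_cell`). -/
def digit {d : ℕ} (x : Fin (d + 1) → ℝ) : ℕ :=
  ⌊(1 - x 0) / x (Fin.last d)⌋₊

/-- The triangle map
`T (x₁, …, xₙ) = (x₂ / x₁, …, xₙ / x₁, (1 - x₁ - b xₙ) / x₁)` for `x ∈ △_b`.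
Its values outside the union of the pieces `△_b` (that is, where `xₙ = 0`) are irrelevant. -/
def T {d : ℕ} (x : Fin (d + 1) → ℝ) : Fin (d + 1) → ℝ :=
  Fin.snoc (α := fun _ => ℝ) (fun i : Fin d => x i.succ / x 0)
    ((1 - x 0 - (digit x : ℝ) * x (Fin.last d)) / x 0)

/-- `b` is the triangle sequence of `x`: `x ∈ △_{b₀}`, `T x ∈ △_{b₁}`, `T² x ∈ △_{b₂}`, …
There is at most one such `b` (see `IsTriangleSequence.unique`), and none if the orbit of `x`
leaves the union of the pieces. -/
def IsTriangleSequence {d : ℕ} (x : Fin (d + 1) → ℝ) (b : ℕ → ℕ) : Prop :=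
  ∀ k, (T^[k] x) ∈ cell d (b k)

theorem digit_eq_of_mem_cell {d b : ℕ} {x : Fin (d + 1) → ℝ} (hx : x ∈ cell d b) :
    digit x = b := by
  obtain ⟨⟨h1, -, h0⟩, hl, hu⟩ := hx
  have hpos : 0 < x (Fin.last d) := by
    rcases h0.lt_or_eq with h | h
    · exact h
    · rw [← h] at hl hu
      linarith
  unfold digit
  rw [Nat.floor_eq_iff (div_nonneg (by linarith) h0), le_div_iff₀ hpos, div_lt_iff₀ hpos]
  constructor <;> linarith

theorem IsTriangleSequence.unique {d : ℕ} {x : Fin (d + 1) → ℝ} {b c : ℕ → ℕ}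
    (hb : IsTriangleSequence x b) (hc : IsTriangleSequence x c) : b = c :=
  funext fun k => (digit_eq_of_mem_cell (hb k)).symm.trans (digit_eq_of_mem_cell (hc k))

end TriangleMap

end

namespace TriangleMap

/-! In homogeneous coordinates `tⱼ = xⱼ - xⱼ₊₁` the triangle map lifts to `coneMap`, whose inverse
branches are linear and preserve volume. Hence the exponential density with rates `L`, restricted to
digit `b`, is carried to the one with rates `child b L`: the conditional law of the future stays in
one explicit family, and digit probabilities are telescoping differences (`weight_child`).

Suppose that for all positive increasing rates the points without a string of `d` zeros have
relative mass at most `p`. Then they have relative mass at most `(1 - c) p` with `c` independent of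
the rates (`exists_mass_noString_le`); iterating, they have mass zero. To find `c`: if the last rate
is at most `ρ` times the first, then `d` zeros come next with probability bounded below. In general,
with probability at least `1/2` the digit is at most `L_last / L 0`; such a digit at most triples
the last rate and moves the lower bounds on the other rates one index down. After `d + 1` such
digits the first and last rates are comparable.

Scale invariance and Fubini transfer the result from the orthant to the simplex. Strings of zeros
also serve every bound `B ≥ 0`. -/

variable {d : ℕ}

/-! ### The triangle map as a piecewise linear map of a cone -/

/-- The open positive orthant. -/
def orthant (d : ℕ) : Set (Fin (d + 2) → ℝ) := {t | ∀ j, 0 < t j}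

/-- The digit in the coordinates `tⱼ = xⱼ - xⱼ₊₁` of the orthant. -/
noncomputable def coneDigit (t : Fin (d + 2) → ℝ) : ℕ := ⌊t 0 / t (Fin.last _)⌋₊

/-- Subtract `b` times the last coordinate from the first, then the new first from the last. -/
noncomputable def slide (b : ℝ) (t : Fin (d + 2) → ℝ) : Fin (d + 2) → ℝ := fun j =>
  if j = 0 then t 0 - b * t (Fin.last _)
  else if j = Fin.last _ then (b + 1) * t (Fin.last _) - t 0 else t j

/-- The inverse of `slide b`. -/
noncomputable def unslide (b : ℝ) (u : Fin (d + 2) → ℝ) : Fin (d + 2) → ℝ := fun j =>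
  if j = 0 then (b + 1) * u 0 + b * u (Fin.last _)
  else if j = Fin.last _ then u (Fin.last _) + u 0 else u j

/-- The triangle map in the homogeneous coordinates `tⱼ = xⱼ - xⱼ₊₁`. -/
noncomputable def coneMap (t : Fin (d + 2) → ℝ) : Fin (d + 2) → ℝ :=
  fun j => slide (coneDigit t) t (j + 1)

/-- The inverse branch of `coneMap` of digit `b`. -/
noncomputable def branch (b : ℝ) (t : Fin (d + 2) → ℝ) : Fin (d + 2) → ℝ :=
  unslide b (fun j => t (j - 1))

/-- The adjoint of `unslide b`. -/
noncomputable def dualSlide (b : ℝ) (L : Fin (d + 2) → ℝ) : Fin (d + 2) → ℝ := fun j =>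
  if j = 0 then L (Fin.last _) + (b + 1) * L 0
  else if j = Fin.last _ then L (Fin.last _) + b * L 0 else L j

/-- The adjoint of `branch b`. -/
noncomputable def child (b : ℝ) (L : Fin (d + 2) → ℝ) : Fin (d + 2) → ℝ :=
  fun j => dualSlide b L (j + 1)

theorem last_ne_zero : Fin.last (d + 1) ≠ 0 := (Fin.last_pos).ne'

theorem slide_unslide (b : ℝ) (u : Fin (d + 2) → ℝ) : slide b (unslide b u) = u := by
  ext j
  have := last_ne_zero (d := d)
  by_cases h0 : j = 0
  · subst h0; simp [slide, unslide, this]; ring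
  · by_cases h1 : j = Fin.last _
    · subst h1; simp [slide, unslide, this]; ring
    · simp [slide, unslide, h0, h1]

theorem sum_ends (f : Fin (d + 2) → ℝ) :
    ∑ j, f j = f 0 + ∑ i : Fin d, f i.castSucc.succ + f (Fin.last _) := by
  rw [Fin.sum_univ_succ, Fin.sum_univ_castSucc, ← add_assoc]; rfl

theorem prod_ends (f : Fin (d + 2) → ℝ) :
    ∏ j, f j = f 0 * (∏ i : Fin d, f i.castSucc.succ) * f (Fin.last _) := by
  rw [Fin.prod_univ_succ, Fin.prod_univ_castSucc, ← mul_assoc]; rfl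

theorem middle_ne_last (i : Fin d) : i.castSucc.succ ≠ Fin.last (d + 1) := by
  rw [← Fin.succ_last]
  exact fun h => (Fin.castSucc_lt_last i).ne (Fin.succ_injective _ h)

theorem sum_mul_unslide (b : ℝ) (L u : Fin (d + 2) → ℝ) :
    ∑ j, L j * unslide b u j = ∑ j, dualSlide b L j * u j := by
  rw [sum_ends, sum_ends]
  simp only [unslide, dualSlide, last_ne_zero, Fin.succ_ne_zero, middle_ne_last, if_true, if_false]
  ring

theorem sum_mul_branch (b : ℝ) (L t : Fin (d + 2) → ℝ) :
    ∑ j, L j * branch b t j = ∑ j, child b L j * t j := by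
  rw [branch, sum_mul_unslide, ← Equiv.sum_comp (Equiv.addRight (1 : Fin (d + 2)))]
  simp [child]

/-- `unslide b` is a product of two transvections. -/
theorem measurePreserving_unslide (b : ℝ) :
    MeasurePreserving (unslide (d := d) b) volume volume := by
  have h0 := last_ne_zero (d := d)
  have h1 := Real.volume_preserving_transvectionStruct
    (⟨Fin.last _, 0, h0, 1⟩ : Matrix.TransvectionStruct (Fin (d + 2)) ℝ)
  have h2 := Real.volume_preserving_transvectionStruct
    (⟨0, Fin.last _, h0.symm, b⟩ : Matrix.TransvectionStruct (Fin (d + 2)) ℝ)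
  convert! h2.comp h1 using 1
  ext u j
  simp only [Function.comp, Matrix.TransvectionStruct.toMatrix, Matrix.transvection,
    Matrix.toLin'_apply, Matrix.add_mulVec, Matrix.one_mulVec, Matrix.single_mulVec,
    Pi.add_apply, Function.update_apply, Pi.zero_apply]
  by_cases hj : j = 0
  · subst hj; simp [unslide, h0.symm]; ring
  · by_cases hj' : j = Fin.last _
    · subst hj'; simp [unslide, h0]
    · simp [unslide, hj, hj']

theorem measurePreserving_branch (b : ℝ) :
    MeasurePreserving (branch (d := d) b) volume volume := by
  have h := volume_measurePreserving_piCongrLeft (fun _ : Fin (d + 2) => ℝ)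
    (Equiv.addRight (1 : Fin (d + 2)))
  convert! (measurePreserving_unslide b).comp h using 1
  ext t j
  simp only [Function.comp, branch]
  congr 1
  ext i
  have := (Equiv.piCongrLeft_apply_apply (fun _ : Fin (d + 2) => ℝ)
    (Equiv.addRight (1 : Fin (d + 2))) t (i - 1))
  simp only [Equiv.coe_addRight, sub_add_cancel] at this
  exact this.symm

theorem slide_branch (b : ℝ) (t : Fin (d + 2) → ℝ) :
    (fun j => slide b (branch b t) (j + 1)) = t := by
  ext j
  rw [branch, slide_unslide]
  simp

theorem measurableEmbedding_branch (b : ℝ) : MeasurableEmbedding (branch (d := d) b) := by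
  refine Continuous.measurableEmbedding ?_
    (Function.LeftInverse.injective (g := fun t j => slide b t (j + 1)) (slide_branch b))
  unfold branch unslide
  refine continuous_pi fun j => ?_
  split_ifs <;> fun_prop

/-! ### Exponential densities and their transformation under a digit -/

/-- The integral over `A` of the density of independent exponential variables of rates `L j`,
not normalised. -/
noncomputable def mass (L : Fin (d + 2) → ℝ) (A : Set (Fin (d + 2) → ℝ)) : ENNReal :=
  ∫⁻ t in A ∩ orthant d, ENNReal.ofReal (Real.exp (-∑ j, L j * t j))

/-- The total mass of `mass L`. -/
noncomputable def weight (L : Fin (d + 2) → ℝ) : ℝ := ∏ j, (L j)⁻¹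

theorem mass_mono (L : Fin (d + 2) → ℝ) {A B : Set (Fin (d + 2) → ℝ)} (h : A ⊆ B) :
    mass L A ≤ mass L B :=
  lintegral_mono_set (Set.inter_subset_inter_left _ h)

/-- Split by the first digit and change variables along each branch; its adjoint acts on the rates.
-/
theorem mass_le_tsum (L : Fin (d + 2) → ℝ) {A : Set (Fin (d + 2) → ℝ)}
    {B : ℕ → Set (Fin (d + 2) → ℝ)}
    (h : ∀ t ∈ A, t ∈ orthant d → coneMap t ∈ B (coneDigit t)) :
    mass L A ≤ ∑' b : ℕ, mass (child b L) (B b) := by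
  have hsub : A ∩ orthant d ⊆ ⋃ b : ℕ, {t | t ∈ A ∧ t ∈ orthant d ∧ coneDigit t = b} :=
    fun t ht => Set.mem_iUnion.2 ⟨coneDigit t, ht.1, ht.2, rfl⟩
  refine (lintegral_mono_set hsub).trans ((lintegral_iUnion_le _ _).trans
    (ENNReal.tsum_le_tsum fun b => ?_))
  rw [← (measurePreserving_branch (b : ℝ)).setLIntegral_comp_preimage_emb
    (measurableEmbedding_branch b)]
  simp only [sum_mul_branch]
  refine lintegral_mono_set' ?_
  -- The floor only gives `0 ≤ t₀ - b t_last`, which is the last coordinate of the image; the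
  -- boundary case is null.
  have hne : ∀ᵐ t : Fin (d + 2) → ℝ, t (Fin.last _) ≠ 0 :=
    Measure.ae_eval_ne (μ := fun _ : Fin (d + 2) => (volume : Measure ℝ)) (Fin.last _) 0
  filter_upwards [hne] with t ht hmem
  obtain ⟨hA, hO, hb⟩ := hmem
  have hS : coneMap (branch (b : ℝ) t) = t := by
    ext j
    simp only [coneMap, hb]
    exact congrFun (slide_branch _ _) j
  have hB := h _ hA hO
  rw [hS, hb] at hB
  refine ⟨hB, ?_⟩
  have hnn : (0 : ℝ) < branch (b : ℝ) t (Fin.last _) := hO _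
  have h0n := hO 0
  unfold coneDigit at hb
  rw [Nat.floor_eq_iff (by positivity), le_div_iff₀ hnn, div_lt_iff₀ hnn] at hb
  intro j
  rw [← slide_branch (b : ℝ) t] at ht ⊢
  simp only [Fin.last_add_one] at ht ⊢
  by_cases hj : j + 1 = 0
  · simp only [slide, hj, if_true] at ht ⊢
    exact lt_of_le_of_ne (by linarith) ht.symm
  · by_cases hj' : j + 1 = Fin.last _
    · simp only [slide, hj', last_ne_zero, if_true, if_false]
      linarith
    · simp only [slide, hj, hj', if_false]
      exact hO _

theorem mass_univ {L : Fin (d + 2) → ℝ} (hL : ∀ j, 0 < L j) :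
    mass L Set.univ = ENNReal.ofReal (weight L) := by
  have hO : orthant d = Set.univ.pi fun _ => Set.Ioi (0 : ℝ) := by
    ext t; simp [orthant]
  have hint : ∀ j, Integrable (fun s : ℝ => Real.exp (-L j * s))
      (volume.restrict (Set.Ioi 0)) := fun j => exp_neg_integrableOn_Ioi 0 (hL j)
  have hexp : ∀ t : Fin (d + 2) → ℝ,
      Real.exp (-∑ j, L j * t j) = ∏ j, Real.exp (-L j * t j) := fun t => by
    rw [← Real.exp_sum, ← Finset.sum_neg_distrib]; simp
  unfold mass
  rw [Set.univ_inter, hO, volume_pi, Measure.restrict_pi_pi]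
  simp only [hexp]
  rw [← ofReal_integral_eq_lintegral_ofReal (Integrable.fintype_prod hint)
    (Filter.Eventually.of_forall fun t => Finset.prod_nonneg fun j _ => (Real.exp_pos _).le),
    integral_fintype_prod_eq_prod (𝕜 := ℝ) (fun j (s : ℝ) => Real.exp (-L j * s))]
  congr 1
  refine Finset.prod_congr rfl fun j _ => ?_
  rw [integral_exp_mul_Ioi (by linarith [hL j])]
  simp

theorem volume_eq_zero_of_mass_eq_zero {L : Fin (d + 2) → ℝ} {A : Set (Fin (d + 2) → ℝ)}
    (h : mass L A = 0) : volume (A ∩ orthant d) = 0 := by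
  unfold mass at h
  rw [lintegral_eq_zero_iff (by fun_prop)] at h
  rw [← Measure.restrict_eq_zero, ← ae_eq_bot]
  refine Filter.empty_mem_iff_bot.1 ?_
  filter_upwards [h] with t ht
  simp only [Pi.zero_apply, ENNReal.ofReal_eq_zero] at ht
  exact absurd (Real.exp_pos _) ht.not_gt

theorem mass_eq_zero_of_volume {L : Fin (d + 2) → ℝ} {A : Set (Fin (d + 2) → ℝ)}
    (h : volume (A ∩ orthant d) = 0) : mass L A = 0 :=
  setLIntegral_measure_zero _ _ h

/-! ### Monotone rates and digit probabilities -/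

/-- The rates that occur as denominators of the vertices of cylinders. -/
structure IsRate (L : Fin (d + 2) → ℝ) : Prop where
  pos : ∀ j, 0 < L j
  mono : Monotone L

theorem child_last (b : ℝ) (L : Fin (d + 2) → ℝ) :
    child b L (Fin.last _) = L (Fin.last _) + (b + 1) * L 0 := by
  simp [child, dualSlide]

theorem child_castSucc (b : ℝ) (L : Fin (d + 2) → ℝ) (i : Fin (d + 1)) :
    child b L i.castSucc =
      if i.succ = Fin.last _ then L (Fin.last _) + b * L 0 else L i.succ := by
  simp [child, dualSlide, Fin.coeSucc_eq_succ]

theorem IsRate.le_child {L : Fin (d + 2) → ℝ} (hL : IsRate L) {b : ℝ} (hb : 0 ≤ b)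
    (i : Fin (d + 1)) : L i.succ ≤ child b L i.castSucc := by
  rw [child_castSucc]
  split_ifs with h
  · rw [h]; nlinarith [hL.pos 0]
  · exact le_rfl

theorem IsRate.child {L : Fin (d + 2) → ℝ} (hL : IsRate L) {b : ℝ} (hb : 0 ≤ b) :
    IsRate (child b L) := by
  have h0 := hL.pos 0
  have hl := hL.pos (Fin.last _)
  have hb0 : 0 ≤ b * L 0 := by positivity
  refine ⟨fun j => ?_, Fin.monotone_iff_le_succ.2 fun i => ?_⟩
  · induction j using Fin.lastCases with
    | last => rw [child_last]; nlinarith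
    | cast i => exact (hL.pos _).trans_le (hL.le_child hb i)
  · induction i using Fin.lastCases with
    | last =>
      rw [child_castSucc, if_pos (Fin.succ_last _), Fin.succ_last, child_last]
      linarith
    | cast i =>
      rw [child_castSucc, if_neg (middle_ne_last i), ← Fin.castSucc_succ]
      refine (hL.mono ?_).trans (hL.le_child hb _)
      rw [Fin.castSucc_succ]
      exact Fin.succ_le_succ_iff.2 (Fin.castSucc_lt_succ).le

/-- The factor multiplying `weight L` is the probability of digit `b`; it telescopes in `b`. -/
theorem weight_child {L : Fin (d + 2) → ℝ} (hL : ∀ j, 0 < L j) {b : ℝ} (hb : 0 ≤ b) :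
    weight (child b L) = weight L * (L (Fin.last _) / (L (Fin.last _) + b * L 0) -
      L (Fin.last _) / (L (Fin.last _) + (b + 1) * L 0)) := by
  have h0 := hL 0
  have hl := hL (Fin.last _)
  have h1 : weight (child b L) = ∏ j, (dualSlide b L j)⁻¹ :=
    Equiv.prod_comp (Equiv.addRight (1 : Fin (d + 2))) (fun j => (dualSlide b L j)⁻¹)
  rw [h1, weight, prod_ends, prod_ends]
  simp only [dualSlide, last_ne_zero, Fin.succ_ne_zero, middle_ne_last, if_true, if_false]
  have hb1 : 0 < L (Fin.last _) + b * L 0 := by positivity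
  have hb2 : 0 < L (Fin.last _) + (b + 1) * L 0 := by positivity
  field_simp
  ring

theorem weight_pos {L : Fin (d + 2) → ℝ} (hL : ∀ j, 0 < L j) : 0 < weight L :=
  Finset.prod_pos fun j _ => inv_pos.2 (hL j)

/-- If after a digit smaller than `J` the mass of the remaining event is at most `(1 - c) p` of the
total, and after any other digit at most `p` of it, then the event has mass at most
`(1 - c P) p` of the total, where `P` is the proportion of digits smaller than `J`. -/
theorem mass_le_of_child {L : Fin (d + 2) → ℝ} (hL : ∀ j, 0 < L j) {p c : ℝ} (hp : 0 ≤ p)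
    (hc0 : 0 ≤ c) (hc1 : c ≤ 1) (J : ℕ) {A : Set (Fin (d + 2) → ℝ)}
    {B : ℕ → Set (Fin (d + 2) → ℝ)}
    (h : ∀ t ∈ A, t ∈ orthant d → coneMap t ∈ B (coneDigit t))
    (h1 : ∀ b < J, mass (child (b : ℝ) L) (B b) ≤ ENNReal.ofReal ((1 - c) * p * weight (child (b : ℝ) L)))
    (h2 : ∀ b : ℕ, mass (child (b : ℝ) L) (B b) ≤
      ENNReal.ofReal (p * weight (child (b : ℝ) L))) :
    mass L A ≤ ENNReal.ofReal
      ((1 - c * (1 - L (Fin.last _) / (L (Fin.last _) + J * L 0))) * p * weight L) := by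
  have h0 := hL 0
  have hl := hL (Fin.last _)
  set G : ℕ → ℝ := fun b => L (Fin.last _) / (L (Fin.last _) + b * L 0) with hG
  have hG0 : ∀ b, 0 ≤ G b := fun b => by simp only [hG]; positivity
  have hw := weight_pos hL
  have hwc : ∀ b : ℕ, weight (child b L) = weight L * (G b - G (b + 1)) := fun b => by
    rw [weight_child hL (Nat.cast_nonneg b)]; simp [hG]
  set e : ℕ → ℝ := fun b => (if b < J then 1 - c else 1) * p * weight (child b L) with he
  have he0 : ∀ b, 0 ≤ e b := fun b => by
    have := (weight_pos (fun j => ?_ : ∀ j, 0 < child (b : ℝ) L j)).le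
    · simp only [he]
      split_ifs
      · exact mul_nonneg (mul_nonneg (by linarith) hp) this
      · positivity
    · unfold child dualSlide
      split_ifs <;> first | positivity | exact hL _
  -- The full sum telescopes to `1 - G m`; the gain `c` stops accruing at `J`.
  have hsum : ∀ m, ∑ b ∈ Finset.range m, e b =
      ((1 - G m) - c * (1 - G (min m J))) * p * weight L := fun m => by
    induction m with
    | zero =>
      have : G 0 = 1 := by simp [hG, hl.ne']
      simp [this]
    | succ m ih =>
      rw [Finset.sum_range_succ, ih]
      simp only [he, hwc]
      split_ifs with hm
      · rw [min_eq_left hm.le, min_eq_left (by omega)]; ring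
      · rw [min_eq_right (by omega), min_eq_right (by omega)]; ring
  refine (mass_le_tsum L h).trans (ENNReal.tsum_le_of_sum_range_le fun m => ?_)
  refine (Finset.sum_le_sum (g := fun b => ENNReal.ofReal (e b)) fun b _ => ?_).trans ?_
  · simp only [he]
    split_ifs with hb
    · exact h1 b hb
    · rw [one_mul]; exact h2 b
  · rw [← ENNReal.ofReal_sum_of_nonneg fun b _ => he0 b, hsum]
    refine ENNReal.ofReal_le_ofReal ?_
    refine mul_le_mul_of_nonneg_right (mul_le_mul_of_nonneg_right ?_ hp) hw.le
    change _ ≤ 1 - c * (1 - G J)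
    rcases le_total J m with hm | hm
    · rw [min_eq_right hm]; linarith [hG0 m]
    · rw [min_eq_left hm]; nlinarith [hG0 m, hG0 J, mul_nonneg hc0 (hG0 J),
        mul_nonneg (sub_nonneg.2 hc1) (hG0 m)]

/-! ### Contraction of the bound on points without strings -/

/-- The points whose sequence of digits contains no string of `d` zeros. -/
def noString (d : ℕ) : Set (Fin (d + 2) → ℝ) :=
  {t | ∀ k, ∃ i < d, coneDigit (coneMap^[k + i] t) ≠ 0}

/-- The points of `noString d` one of whose first `m` digits is not zero. -/
def noStringFrom (d m : ℕ) : Set (Fin (d + 2) → ℝ) :=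
  {t | t ∈ noString d ∧ ∃ i < m, coneDigit (coneMap^[i] t) ≠ 0}

theorem coneMap_mem_noString {t : Fin (d + 2) → ℝ} (h : t ∈ noString d) :
    coneMap t ∈ noString d := fun k => by
  obtain ⟨i, hi, h⟩ := h (k + 1)
  refine ⟨i, hi, ?_⟩
  rwa [← Function.iterate_succ_apply, show (k + i).succ = k + 1 + i by omega]

theorem noString_subset : noString d ⊆ noStringFrom d d := fun t h => by
  obtain ⟨i, hi, h'⟩ := h 0
  exact ⟨h, i, hi, by rwa [zero_add] at h'⟩

theorem coneMap_mem_noStringFrom {m : ℕ} {t : Fin (d + 2) → ℝ}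
    (h : t ∈ noStringFrom d (m + 1)) (h0 : coneDigit t = 0) : coneMap t ∈ noStringFrom d m := by
  obtain ⟨h, i, hi, hne⟩ := h
  refine ⟨coneMap_mem_noString h, ?_⟩
  cases i with
  | zero => exact absurd h0 hne
  | succ i => exact ⟨i, by omega, by rwa [Function.iterate_succ_apply] at hne⟩

/-- When the last and first rates are comparable, a zero digit has probability at least `1 / (1 +
ρ)`. After `m` zeros the event is empty. -/
theorem exists_mass_noStringFrom_le (m : ℕ) : ∀ ρ : ℝ, 0 < ρ → ∃ c : ℝ, 0 < c ∧ c ≤ 1 ∧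
    ∀ p : ℝ, 0 ≤ p → (∀ L : Fin (d + 2) → ℝ, IsRate L →
      mass L (noString d) ≤ ENNReal.ofReal (p * weight L)) →
    ∀ L : Fin (d + 2) → ℝ, IsRate L → L (Fin.last _) ≤ ρ * L 0 →
      mass L (noStringFrom d m) ≤ ENNReal.ofReal ((1 - c) * p * weight L) := by
  induction m with
  | zero =>
    refine fun ρ _ => ⟨1, one_pos, le_rfl, fun p _ _ L _ _ => ?_⟩
    have : noStringFrom d 0 = ∅ := by ext; simp [noStringFrom]
    simp [this, mass]
  | succ m ih =>
    intro ρ hρ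
    -- Digit zero turns the last rate into `L_last + L 0 ≤ 2 L_last` and does not lower the first.
    obtain ⟨c, hc0, hc1, hc⟩ := ih (2 * ρ) (by positivity)
    refine ⟨c / (1 + ρ), by positivity, (div_le_one (by positivity)).2 (by linarith),
      fun p hp hall L hL hLρ => ?_⟩
    have h0 := hL.pos 0
    have hl := hL.pos (Fin.last _)
    have h0l : L 0 ≤ L (Fin.last _) := hL.mono (Fin.zero_le _)
    have hchild : ∀ b : ℕ, IsRate (child (b : ℝ) L) := fun b => hL.child (Nat.cast_nonneg b)
    refine (mass_le_of_child hL.pos hp hc0.le hc1 1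
      (B := fun b => if b = 0 then noStringFrom d m else noString d) ?_ ?_ ?_).trans ?_
    · intro t ht _
      split_ifs with hb
      · exact coneMap_mem_noStringFrom ht hb
      · exact coneMap_mem_noString ht.1
    · intro b hb
      obtain rfl : b = 0 := by omega
      rw [if_pos rfl]
      refine hc p hp hall _ (hchild 0) ?_
      have h1 : L 0 ≤ child ((0 : ℕ) : ℝ) L 0 :=
        (hL.mono (Fin.zero_le _)).trans (hL.le_child (Nat.cast_nonneg 0) 0)
      rw [child_last]
      push_cast at h1 ⊢
      nlinarith
    · intro b
      refine (mass_mono _ ?_).trans (hall _ (hchild b))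
      split_ifs
      · exact fun t ht => ht.1
      · exact subset_rfl
    · refine ENNReal.ofReal_le_ofReal (mul_le_mul_of_nonneg_right
        (mul_le_mul_of_nonneg_right ?_ hp) (weight_pos hL.pos).le)
      have : 1 / (1 + ρ) ≤ 1 - L (Fin.last _) / (L (Fin.last _) + (1 : ℕ) * L 0) := by
        rw [one_sub_div (by positivity), div_le_div_iff₀ (by positivity) (by positivity)]
        push_cast
        nlinarith
      have := mul_le_mul_of_nonneg_left this hc0.le
      rw [mul_one_div] at this
      linarith

theorem exists_mass_noString_le (i : Fin (d + 2)) : ∀ ρ : ℝ, 0 < ρ → ∃ c : ℝ, 0 < c ∧ c ≤ 1 ∧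
    ∀ p : ℝ, 0 ≤ p → (∀ L : Fin (d + 2) → ℝ, IsRate L →
      mass L (noString d) ≤ ENNReal.ofReal (p * weight L)) →
    ∀ L : Fin (d + 2) → ℝ, IsRate L → L (Fin.last _) ≤ ρ * L i →
      mass L (noString d) ≤ ENNReal.ofReal ((1 - c) * p * weight L) := by
  induction i using Fin.induction with
  | zero =>
    intro ρ hρ
    obtain ⟨c, hc0, hc1, hc⟩ := exists_mass_noStringFrom_le (d := d) d ρ hρ
    exact ⟨c, hc0, hc1, fun p hp hall L hL h =>
      (mass_mono L noString_subset).trans (hc p hp hall L hL h)⟩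
  | succ i ih =>
    intro ρ hρ
    -- If `b L 0 ≤ L_last`, the new last rate `L_last + (b + 1) L 0` is at most `3 L_last`.
    obtain ⟨c, hc0, hc1, hc⟩ := ih (3 * ρ) (by positivity)
    refine ⟨c / 2, by positivity, by linarith, fun p hp hall L hL hLρ => ?_⟩
    have h0 := hL.pos 0
    have hl := hL.pos (Fin.last _)
    have h0l : L 0 ≤ L (Fin.last _) := hL.mono (Fin.zero_le _)
    have hchild : ∀ b : ℕ, IsRate (child (b : ℝ) L) := fun b => hL.child (Nat.cast_nonneg b)
    set J : ℕ := ⌊L (Fin.last _) / L 0⌋₊ + 1 with hJ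
    refine (mass_le_of_child hL.pos hp hc0.le hc1 J (B := fun _ => noString d)
      (fun t ht _ => coneMap_mem_noString ht) ?_ fun b => hall _ (hchild b)).trans ?_
    · intro b hb
      refine hc p hp hall _ (hchild b) ?_
      have hb' : (b : ℝ) ≤ L (Fin.last _) / L 0 :=
        (Nat.le_floor_iff (by positivity)).1 (by omega)
      rw [le_div_iff₀ h0] at hb'
      have := mul_le_mul_of_nonneg_left (hL.le_child (Nat.cast_nonneg (α := ℝ) b) i) hρ.le
      rw [child_last]
      nlinarith
    · refine ENNReal.ofReal_le_ofReal (mul_le_mul_of_nonneg_right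
        (mul_le_mul_of_nonneg_right ?_ hp) (weight_pos hL.pos).le)
      have hJ' : L (Fin.last _) ≤ J * L 0 := by
        rw [← div_le_iff₀ h0, hJ]
        push_cast
        exact (Nat.lt_floor_add_one _).le
      have : L (Fin.last _) / (L (Fin.last _) + J * L 0) ≤ 1 / 2 := by
        rw [div_le_div_iff₀ (by positivity) (by positivity)]
        linarith
      nlinarith

theorem mass_noString_eq_zero {L : Fin (d + 2) → ℝ} (hL : IsRate L) :
    mass L (noString d) = 0 := by
  -- At the last index with `ρ = 1` the comparability condition always holds, so `c` serves all
  -- rates.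
  obtain ⟨c, hc0, hc1, hc⟩ := exists_mass_noString_le (Fin.last (d + 1)) 1 one_pos
  have key : ∀ m : ℕ, ∀ L : Fin (d + 2) → ℝ, IsRate L →
      mass L (noString d) ≤ ENNReal.ofReal ((1 - c) ^ m * weight L) := by
    intro m
    induction m with
    | zero =>
      intro L hL
      rw [pow_zero, one_mul, ← mass_univ hL.pos]
      exact mass_mono L (Set.subset_univ _)
    | succ m ih =>
      intro L hL
      rw [pow_succ']
      exact hc _ (pow_nonneg (by linarith) m) ih L hL (by rw [one_mul])
  have hlim : Filter.Tendsto (fun m : ℕ => ENNReal.ofReal ((1 - c) ^ m * weight L))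
      Filter.atTop (nhds 0) := by
    rw [← ENNReal.ofReal_zero]
    refine ENNReal.tendsto_ofReal ?_
    simpa using (tendsto_pow_atTop_nhds_zero_of_lt_one (by linarith : 0 ≤ 1 - c)
      (by linarith)).mul_const (weight L)
  exact le_antisymm (ge_of_tendsto' hlim fun m => key m L hL) zero_le

/-! ### Almost every orbit in the orthant -/

theorem mass_iterate_eq_zero {A : Set (Fin (d + 2) → ℝ)}
    (h : ∀ L : Fin (d + 2) → ℝ, IsRate L → mass L A = 0) (k : ℕ) :
    ∀ L : Fin (d + 2) → ℝ, IsRate L → mass L (coneMap^[k] ⁻¹' A) = 0 := by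
  induction k with
  | zero => exact h
  | succ k ih =>
    intro L hL
    refine le_antisymm ((mass_le_tsum L (B := fun _ => coneMap^[k] ⁻¹' A) fun t ht _ => ?_).trans
      ?_) zero_le
    · simpa using ht
    · simp [ih _ (hL.child (Nat.cast_nonneg _))]

theorem ae_iterate_coneMap : ∀ᵐ t : Fin (d + 2) → ℝ, (∀ j, 0 ≤ t j) →
    (∀ k, coneMap^[k] t ∈ orthant d) ∧
      {k : ℕ | ∀ i < d, coneDigit (coneMap^[k + i] t) = 0}.Infinite := by
  have hrate : IsRate (fun _ : Fin (d + 2) => (1 : ℝ)) :=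
    ⟨fun _ => one_pos, fun _ _ _ => le_rfl⟩
  have hnull : ∀ A : Set (Fin (d + 2) → ℝ), (∀ L : Fin (d + 2) → ℝ, IsRate L → mass L A = 0) →
      ∀ᵐ t : Fin (d + 2) → ℝ, t ∈ orthant d → ∀ k, coneMap^[k] t ∉ A := fun A hA => by
    have : ∀ k, ∀ᵐ t : Fin (d + 2) → ℝ, t ∈ orthant d → coneMap^[k] t ∉ A := fun k => by
      rw [ae_iff]
      convert volume_eq_zero_of_mass_eq_zero (mass_iterate_eq_zero hA k _ hrate) using 2
      ext t
      simp [and_comm]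
    filter_upwards [ae_all_iff.2 this] with t ht hO k using ht k hO
  have hne : ∀ᵐ t : Fin (d + 2) → ℝ, ∀ j, t j ≠ 0 := ae_all_iff.2 fun j =>
    Measure.ae_eval_ne (μ := fun _ : Fin (d + 2) => (volume : Measure ℝ)) j 0
  filter_upwards [hne, hnull _ fun L hL => mass_noString_eq_zero hL,
    -- `mass` only sees the orthant, so its complement has mass zero; pulling back shows that almost
    -- every orbit stays inside.
    hnull (orthant d)ᶜ fun L _ => mass_eq_zero_of_volume (by simp)] with t hne h1 h2 hnn
  have hO : t ∈ orthant d := fun j => lt_of_le_of_ne (hnn j) (hne j).symm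
  refine ⟨fun k => not_not.1 (h2 hO k), Nat.frequently_atTop_iff_infinite.1 <|
    Filter.frequently_atTop.2 fun K => ?_⟩
  have := h1 hO K
  simp only [noString, Set.mem_ofPred_eq, not_forall, not_exists, not_and, not_not] at this
  obtain ⟨k, hk⟩ := this
  refine ⟨K + k, Nat.le_add_right _ _, fun i hi => ?_⟩
  have := hk i hi
  rwa [← Function.iterate_add_apply, show k + i + K = K + k + i by omega] at this

/-! ### Transfer from the cone to the simplex -/

/-- The differences `xⱼ - xⱼ₊₁`, where `x₀ = s` and the last subtrahend is `0`. -/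
noncomputable def gaps (s : ℝ) (x : Fin (d + 1) → ℝ) : Fin (d + 2) → ℝ := fun j =>
  (Fin.cons s x : Fin (d + 2) → ℝ) j - (Fin.snoc x 0 : Fin (d + 2) → ℝ) j

theorem gaps_zero (s : ℝ) (x : Fin (d + 1) → ℝ) : gaps s x 0 = s - x 0 := by
  have : (Fin.snoc x 0 : Fin (d + 2) → ℝ) (Fin.castSucc 0) = x 0 := Fin.snoc_castSucc _ _ _
  rw [gaps, Fin.cons_zero, ← this, Fin.castSucc_zero]

theorem gaps_last (s : ℝ) (x : Fin (d + 1) → ℝ) : gaps s x (Fin.last _) = x (Fin.last _) := by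
  have : (Fin.cons s x : Fin (d + 2) → ℝ) (Fin.last d).succ = x (Fin.last d) :=
    Fin.cons_succ _ _ _
  rw [gaps, Fin.snoc_last, sub_zero, ← this, Fin.succ_last]

theorem gaps_middle (s : ℝ) (x : Fin (d + 1) → ℝ) (i : Fin d) :
    gaps s x i.castSucc.succ = x i.castSucc - x i.succ := by
  have : (Fin.snoc x 0 : Fin (d + 2) → ℝ) i.succ.castSucc = x i.succ := Fin.snoc_castSucc _ _ _
  rw [gaps, Fin.cons_succ, ← this, Fin.castSucc_succ]

theorem gaps_smul (s : ℝ) (x : Fin (d + 1) → ℝ) : gaps s (s • x) = s • gaps 1 x := by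
  ext j
  simp only [gaps, Pi.smul_apply, smul_eq_mul, mul_sub]
  congr 1
  · cases j using Fin.cases <;> simp
  · cases j using Fin.lastCases <;> simp

theorem coneDigit_gaps (x : Fin (d + 1) → ℝ) : coneDigit (gaps 1 x) = digit x := by
  rw [coneDigit, digit, gaps_zero, gaps_last]

theorem gaps_nonneg {x : Fin (d + 1) → ℝ} (hx : x ∈ simplex d) (j : Fin (d + 2)) :
    0 ≤ gaps 1 x j := by
  obtain ⟨h1, hanti, h0⟩ := hx
  cases j using Fin.cases with
  | zero => rw [gaps_zero]; linarith
  | succ i =>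
    cases i using Fin.lastCases with
    | last => rwa [Fin.succ_last, gaps_last]
    | cast i => rw [gaps_middle]; linarith [hanti (Fin.castSucc_lt_succ (i := i)).le]

theorem mem_cell_digit {x : Fin (d + 1) → ℝ} (hx : gaps 1 x ∈ orthant d) :
    x ∈ cell d (digit x) := by
  have h0 := hx 0
  have hl := hx (Fin.last _)
  rw [gaps_zero] at h0
  rw [gaps_last] at hl
  have hdig : digit x = digit x := rfl
  conv_lhs at hdig => unfold digit
  rw [Nat.floor_eq_iff (by positivity), le_div_iff₀ hl, div_lt_iff₀ hl] at hdig
  refine ⟨⟨by linarith, Fin.antitone_iff_succ_le.2 fun i => ?_, hl.le⟩, by linarith, by linarith⟩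
  have := hx i.castSucc.succ
  rw [gaps_middle] at this
  linarith

theorem head_pos {x : Fin (d + 1) → ℝ} (hx : gaps 1 x ∈ orthant d) : 0 < x 0 := by
  have hl := hx (Fin.last _)
  rw [gaps_last] at hl
  exact hl.trans_le ((mem_cell_digit hx).1.2.1 (Fin.zero_le _))

theorem cons_T_castSucc {x : Fin (d + 1) → ℝ} (hx : x 0 ≠ 0) (i : Fin (d + 1)) :
    (Fin.cons 1 (T x) : Fin (d + 2) → ℝ) i.castSucc = x i / x 0 := by
  cases i using Fin.cases with
  | zero => rw [Fin.castSucc_zero, Fin.cons_zero, div_self hx]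
  | succ i => rw [Fin.castSucc_succ, Fin.cons_succ, T, Fin.snoc_castSucc]

theorem gaps_T {x : Fin (d + 1) → ℝ} (hx : x 0 ≠ 0) :
    gaps 1 (T x) = (x 0)⁻¹ • coneMap (gaps 1 x) := by
  ext j
  rw [Pi.smul_apply, smul_eq_mul, coneMap, coneDigit_gaps]
  cases j using Fin.lastCases with
  | last =>
    rw [gaps_last, Fin.last_add_one, slide, if_pos rfl, gaps_zero, gaps_last, T, Fin.snoc_last]
    field_simp
  | cast i =>
    rw [Fin.coeSucc_eq_succ, gaps, cons_T_castSucc hx, Fin.snoc_castSucc, slide,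
      if_neg (Fin.succ_ne_zero _)]
    cases i using Fin.lastCases with
    | last =>
      rw [if_pos (Fin.succ_last _), gaps_zero, gaps_last, T, Fin.snoc_last]
      field_simp
      ring
    | cast i =>
      rw [if_neg (middle_ne_last i), gaps_middle, T, Fin.snoc_castSucc]
      field_simp

theorem coneDigit_smul {r : ℝ} (hr : 0 < r) (t : Fin (d + 2) → ℝ) :
    coneDigit (r • t) = coneDigit t := by
  simp [coneDigit, mul_div_mul_left _ _ hr.ne']

theorem coneMap_smul {r : ℝ} (hr : 0 < r) (t : Fin (d + 2) → ℝ) :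
    coneMap (r • t) = r • coneMap t := by
  ext j
  simp only [coneMap, coneDigit_smul hr, slide, Pi.smul_apply, smul_eq_mul]
  split_ifs <;> ring

theorem iterate_coneMap_smul {r : ℝ} (hr : 0 < r) (k : ℕ) (t : Fin (d + 2) → ℝ) :
    coneMap^[k] (r • t) = r • coneMap^[k] t := by
  induction k with
  | zero => rfl
  | succ k ih => rw [Function.iterate_succ_apply', Function.iterate_succ_apply', ih,
      coneMap_smul hr]

theorem smul_mem_orthant {r : ℝ} (hr : 0 < r) {t : Fin (d + 2) → ℝ} :
    r • t ∈ orthant d ↔ t ∈ orthant d := by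
  simp [orthant, hr]

theorem exists_gaps_iterate_T {x : Fin (d + 1) → ℝ}
    (hx : ∀ k, coneMap^[k] (gaps 1 x) ∈ orthant d) (k : ℕ) :
    ∃ r : ℝ, 0 < r ∧ gaps 1 (T^[k] x) = r • coneMap^[k] (gaps 1 x) := by
  induction k with
  | zero => exact ⟨1, one_pos, by simp⟩
  | succ k ih =>
    obtain ⟨r, hr, h⟩ := ih
    have hpos : 0 < (T^[k] x) 0 := head_pos (by rw [h]; exact (smul_mem_orthant hr).2 (hx k))
    refine ⟨((T^[k] x) 0)⁻¹ * r, by positivity, ?_⟩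
    rw [Function.iterate_succ_apply', gaps_T hpos.ne', h, coneMap_smul hr,
      Function.iterate_succ_apply', smul_smul]

/-- The linear map `X ↦ gaps (X 0) (X 1, …, X (d + 1))`. -/
noncomputable def gapsLinear (d : ℕ) : (Fin (d + 2) → ℝ) →ₗ[ℝ] (Fin (d + 2) → ℝ) where
  toFun X := gaps (X 0) (Fin.tail X)
  map_add' X Y := by
    ext j
    cases j using Fin.cases with
    | zero => simp only [Pi.add_apply, gaps_zero, Fin.tail]; ring
    | succ i =>
      cases i using Fin.lastCases with
      | last => simp [Fin.succ_last, gaps_last, Fin.tail]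
      | cast i => simp only [Pi.add_apply, gaps_middle, Fin.tail]; ring
  map_smul' r X := by
    ext j
    cases j using Fin.cases with
    | zero => simp only [Pi.smul_apply, smul_eq_mul, gaps_zero, Fin.tail, RingHom.id_apply]; ring
    | succ i =>
      cases i using Fin.lastCases with
      | last => simp [Fin.succ_last, gaps_last, Fin.tail]
      | cast i =>
        simp only [Pi.smul_apply, smul_eq_mul, gaps_middle, Fin.tail, RingHom.id_apply]; ring

theorem gapsLinear_injective : Function.Injective (gapsLinear d) := by
  rw [injective_iff_map_eq_zero]
  intro X hX
  have h : ∀ j, gaps (X 0) (Fin.tail X) j = 0 := fun j => congrFun hX j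
  have htail : ∀ i : Fin (d + 1), Fin.tail X i = 0 := fun i => by
    induction i using Fin.reverseInduction with
    | last => rw [← gaps_last (X 0) (Fin.tail X)]; exact h _
    | cast i ih =>
      have := h i.castSucc.succ
      rw [gaps_middle, ih, sub_zero] at this
      exact this
  ext j
  cases j using Fin.cases with
  | zero =>
    have := h 0
    rw [gaps_zero, htail, sub_zero] at this
    exact this
  | succ i => exact htail i

/-- The simplex sits in a null slice `s = 1` of the cone. Fubini gives the property on some slice `s
> 0`, and scaling moves it to `s = 1`. -/
theorem ae_of_ae_gaps {P : (Fin (d + 2) → ℝ) → Prop} (hP : ∀ᵐ t, P t)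
    (hsmul : ∀ r : ℝ, 0 < r → ∀ t, P (r • t) → P t) :
    ∀ᵐ x : Fin (d + 1) → ℝ, P (gaps 1 x) := by
  have hdet : LinearMap.det (gapsLinear d) ≠ 0 :=
    (LinearEquiv.isUnit_det' (LinearEquiv.ofInjectiveEndo _ gapsLinear_injective)).ne_zero
  have h1 : ∀ᵐ X : Fin (d + 2) → ℝ, P (gapsLinear d X) := by
    exact (Measure.LinearMap.quasiMeasurePreserving volume _ hdet).ae hP
  have h2 : ∀ᵐ z : ℝ × (Fin (d + 1) → ℝ), P (gaps z.1 z.2) := by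
    have := ((volume_preserving_piFinSuccAbove (fun _ : Fin (d + 2) => ℝ) 0).symm
      _).quasiMeasurePreserving.ae h1
    filter_upwards [this] with z hz
    simpa [gapsLinear, MeasurableEquiv.piFinSuccAbove, Fin.consEquiv] using hz
  have h3 := Measure.ae_ae_of_ae_prod h2
  obtain ⟨s, hs, hs0⟩ : ∃ s : ℝ, (∀ᵐ x : Fin (d + 1) → ℝ, P (gaps s x)) ∧ 0 < s := by
    by_contra! hcon
    have : ∀ᵐ s : ℝ, s ∉ Set.Ioi (0 : ℝ) := by
      filter_upwards [h3] with s hs using not_lt.2 (hcon s hs)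
    rw [ae_iff] at this
    simp only [not_not, Set.ofPred_mem_eq, Real.volume_Ioi, ENNReal.top_ne_zero] at this
  have h4 : ∀ᵐ x : Fin (d + 1) → ℝ, P (gaps s (s • x)) := by
    exact (Measure.quasiMeasurePreserving_smul volume hs0.ne').ae hs
  filter_upwards [h4] with x hx
  rw [gaps_smul] at hx
  exact hsmul s hs0 _ hx

theorem ae_exists_isTriangleSequence (d : ℕ) :
    ∀ᵐ x : Fin (d + 1) → ℝ, x ∈ simplex d →
      ∃ b : ℕ → ℕ, IsTriangleSequence x b ∧ {k : ℕ | ∀ i < d, b (k + i) = 0}.Infinite := by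
  have h := ae_of_ae_gaps (d := d) ae_iterate_coneMap fun r hr t ht hnn => by
    have := ht fun j => mul_nonneg hr.le (hnn j)
    simpa only [iterate_coneMap_smul hr, smul_mem_orthant hr, coneDigit_smul hr] using this
  filter_upwards [h] with x hx hmem
  obtain ⟨hO, hinf⟩ := hx (gaps_nonneg hmem)
  have hr := exists_gaps_iterate_T hO
  refine ⟨fun k => digit (T^[k] x), fun k => ?_, ?_⟩
  · obtain ⟨r, hr, h⟩ := hr k
    exact mem_cell_digit (by rw [h]; exact (smul_mem_orthant hr).2 (hO k))
  · convert hinf using 6 with k i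
    obtain ⟨r, hr, h⟩ := hr (k + i)
    change digit (T^[k + i] x) = _
    rw [← coneDigit_gaps, h, coneDigit_smul hr]

end TriangleMap

/-- In dimension `n = d + 1`, strings of length `n - 1` have length `d`; a string is recorded by
the index `k` at which it starts. -/
theorem mainTheorem4 (d : ℕ) :
    (∀ᵐ x ∂(volume : Measure (Fin (d + 1) → ℝ)), x ∈ TriangleMap.simplex d →
      ∃ b : ℕ → ℕ, TriangleMap.IsTriangleSequence x b ∧
        {k : ℕ | ∀ i < d, b (k + i) = 0}.Infinite) ∧
    (∀ B : ℝ, 0 ≤ B →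
      ∀ᵐ x ∂(volume : Measure (Fin (d + 1) → ℝ)), x ∈ TriangleMap.simplex d →
        ∃ b : ℕ → ℕ, TriangleMap.IsTriangleSequence x b ∧
          {k : ℕ | ∀ i < d, (b (k + i) : ℝ) ≤ B}.Infinite) := by
  refine ⟨TriangleMap.ae_exists_isTriangleSequence d, fun B hB => ?_⟩
  filter_upwards [TriangleMap.ae_exists_isTriangleSequence d] with x hx hmem
  obtain ⟨b, hb, hinf⟩ := hx hmem
  exact ⟨b, hb, hinf.mono fun k hk i hi => by simpa [hk i hi] using hB⟩
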